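/- Consider the planar four-vortex problem with circulations $\Gamma_1=\Gamma_2=\Gamma_3=1$ and $\Gamma_4=m\in\mathbb{R}$, that is, the system $$\dot z_i = J\sum_{j\ne i}\frac{\Gamma_j}{\|z_i-z_j\|^2}\,(z_j-z_i),\qquad z_i\in\mathbb{R}^2,\quad 1\le i\le 4,\qquad J=\begin{pmatrix}0&1\\-1&0\end{pmatrix}.$$ A relative equilibrium is a configuration $z=(z_1,\dots,z_4)$ of distinct points for which $z_i(t)=c+e^{-\omega Jt}(z_i-c)$, $1\le i\le 4$, is a solution for some angular velocity $\omega\neq 0$, where $c=\frac1\Gamma\sum_i\Gamma_i z_i$ is the center of vorticity and $\Gamma=\sum_i\Gamma_i$ (if $\Gamma=0$, any point $c$ is allowed). Relative equilibria are counted up to translation, scaling and rotation (reflected configurations are not identified). A relative equilibrium is collinear if the four points lie on a line; its ordering is the order of the vortices along this line, where an order and its reverse are identified (by a rotation through $180^\circ$), so that there are 12 orderings. Group I consists of the 6 orderings in which vortex 4 is exterior to the other three vortices, Group II of the 6 orderings in which vortex 4 lies between two of the others. (i) If $m>-1/2$, there are exactly 12 collinear relative equilibria, exactly one for each of the 12 orderings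 (so both groups are realized). (ii) If $-1<m\le -1/2$, there are exactly 6 collinear relative equilibria, exactly one for each ordering in Group I (and none with an ordering in Group II). (iii) If $m\le -1$, there are no collinear relative equilibria. -/

import Mathlib

namespace Vortex

open Complex

/-- A configuration of `n` point vortices in the plane; the plane `ℝ²` is identified with `ℂ`
by `(x, y) ↦ x + y * I`. -/
abbrev Config (n : ℕ) : Type := Fin n → ℂ

/-- The velocity of the `i`-th vortex in the planar `n`-vortex problem with circulations `Γ`:
`J ∑_{j ≠ i} (Γ j / r_{ij} ^ 2) (z_j - z_i)` with `J = [[0, 1], [-1, 0]]`, which is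
multiplication by `-I` on `ℂ`. This is Kirchhoff's equation after cancelling the common factor
`Γ i`, so that a vortex with zero circulation is advected by the others. -/
noncomputable def velocity {n : ℕ} (Γ : Fin n → ℝ) (z : Config n) (i : Fin n) : ℂ :=
  -I * ∑ j ∈ Finset.univ.erase i, ((Γ j / ‖z i - z j‖ ^ 2 : ℝ) : ℂ) * (z j - z i)

/-- A solution, defined for all times and free of collisions, of the planar `n`-vortex problem. -/
def IsSolution {n : ℕ} (Γ : Fin n → ℝ) (z : ℝ → Config n) : Prop :=
  ∀ t : ℝ, Function.Injective (z t) ∧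
    ∀ i : Fin n, HasDerivAt (fun s => z s i) (velocity Γ (z t) i) t

/-- The center of vorticity `c = (1 / Γ) ∑ i, Γ_i z_i` (meaningful if `Γ = ∑ i, Γ_i ≠ 0`). -/
noncomputable def centerOfVorticity {n : ℕ} (Γ : Fin n → ℝ) (z : Config n) : ℂ :=
  (∑ i, (Γ i : ℂ) * z i) / ((∑ i, Γ i : ℝ) : ℂ)

/-- The uniform rotation of the configuration `z` about `c` with angular velocity `ω`,
`z_i(t) = c + e^{-ω J t} (z_i - c)`; here `-J` is multiplication by `I`. -/
noncomputable def rotate {n : ℕ} (ω : ℝ) (c : ℂ) (z : Config n) (t : ℝ) : Config n :=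
  fun i => c + exp ((ω * t : ℝ) * I) * (z i - c)

/-- `z` is (the initial position of) a relative equilibrium: the uniform rotation of `z` about the
center of vorticity, with some angular velocity `ω ≠ 0`, solves the `n`-vortex problem.
If the total circulation is zero, there is no center of vorticity, and a rotation about any
point `c` is admitted. -/
def IsRelativeEquilibrium {n : ℕ} (Γ : Fin n → ℝ) (z : Config n) : Prop :=
  ∃ (ω : ℝ) (c : ℂ), ω ≠ 0 ∧ (∑ i, Γ i ≠ 0 → c = centerOfVorticity Γ z) ∧
    IsSolution Γ (rotate ω c z)

/-- Two configurations are equivalent if one is obtained from the other by translation, scaling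
and rotation, that is, by a map `x ↦ a * x + b` with `a ≠ 0`
(scaling factor `‖a‖`, angle of rotation `arg a`). Reflections are not allowed. -/
def configSetoid (n : ℕ) : Setoid (Config n) where
  r w z := ∃ a b : ℂ, a ≠ 0 ∧ ∀ i, w i = a * z i + b
  iseqv :=
    { refl := fun _ => ⟨1, 0, one_ne_zero, fun _ => by ring⟩
      symm := by
        rintro w z ⟨a, b, ha, h⟩
        refine ⟨a⁻¹, -(a⁻¹ * b), inv_ne_zero ha, fun i => ?_⟩
        rw [h i]
        field_simp
        ring
      trans := by
        rintro w z y ⟨a, b, ha, h⟩ ⟨a', b', ha', h'⟩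
        refine ⟨a * a', a * b' + b, mul_ne_zero ha ha', fun i => ?_⟩
        rw [h i, h' i]
        ring }

/-- Configurations up to translation, scaling and rotation. -/
abbrev ConfigClass (n : ℕ) : Type := Quotient (configSetoid n)

/-- The equivalence classes of collinear relative equilibria for the circulations `Γ`. -/
def collinearRE {n : ℕ} (Γ : Fin n → ℝ) : Set (ConfigClass n) :=
  Quotient.mk (configSetoid n) ''
    {z | IsRelativeEquilibrium Γ z ∧ Collinear ℝ (Set.range z)}

/-- The points of `z` lie on a line `p + ℝ u` and, in one of its two directions, are met in the
order `σ 0, σ 1, …, σ (n - 1)`. As the two directions of a line are interchanged by the rotation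
by `180°`, `σ` and its reversal stand for the same ordering. -/
def HasOrdering {n : ℕ} (z : Config n) (σ : Equiv.Perm (Fin n)) : Prop :=
  ∃ (p u : ℂ) (x : Fin n → ℝ), u ≠ 0 ∧ (∀ i, z i = p + x i * u) ∧ StrictMono fun k => x (σ k)

/-- An equivalence class of configurations has the ordering `σ` if its members have it. -/
def ClassHasOrdering {n : ℕ} (q : ConfigClass n) (σ : Equiv.Perm (Fin n)) : Prop :=
  ∃ z : Config n, Quotient.mk (configSetoid n) z = q ∧ HasOrdering z σ

/-- The circulations `Γ₁ = Γ₂ = Γ₃ = 1`, `Γ₄ = m` (vortex `k` has the index `k - 1`). -/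
def circ (m : ℝ) : Fin 4 → ℝ := ![1, 1, 1, m]

/-- Group I: vortex 4 is exterior to the three equal vortices. -/
def GroupI (σ : Equiv.Perm (Fin 4)) : Prop := σ 0 = 3 ∨ σ 3 = 3

/-- Group II: vortex 4 lies between two equal vortices. -/
def GroupII (σ : Equiv.Perm (Fin 4)) : Prop := σ 1 = 3 ∨ σ 2 = 3

/-- The twelve orderings of four vortices on a line: of the two permutations that describe an
ordering, the one in which vortex 1 precedes vortex 2 is kept. -/
def orderings : Set (Equiv.Perm (Fin 4)) := {σ | σ.symm 0 < σ.symm 1}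

end Vortex

/-!
A collinear relative equilibrium has the form `z i = p + x i * u` with real `x i`, and the equations
of motion reduce to `∑_{j ≠ i} Γ j / (x i - x j) = ω (x i - k)`. Put vortex 4 at the origin and let
`a, b, c` be the positions of the unit vortices (`LineEquilibrium`).

If `m ≤ -1`, two expressions for `ω` (difference of the equations of two unit vortices, difference
of the equations of a unit vortex and vortex 4) have opposite signs whatever the order of the
points, so there is no solution (`LineEquilibrium.neg_one_lt`).

The center `k` cannot coincide with vortex 4, so scaling makes `k = 1`, and this representative of
a class is unique. With `t = m + 1` and `v = 1 / ω` the equations then say that `a, b, c` are the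
roots of the cubic
`P = X ^ 3 - (t + 2) X ^ 2 + e X - e v`, `e = ((t + 1) (t + 2) - 3 t v) / 2`, where `v` is a root of
the quadratic `G = 9 t v ^ 2 - (10 t ^ 2 + 15 t + 2) v + t (t + 1) (t + 2)` (`NormalForm`). For such
`v` the cubic satisfies
`v X P'' / 2 + ((t - 1) v - X (X - 1)) P' + (3 X + t - 1) P = 0` (`cubic_ode`), which determines the
sign of `P` at its critical points.

Let `t > 0`. Always `G (t + 1) < 0`, and `e = 0` at `v₀ = (t + 1) (t + 2) / (3 t)`.

* Vortex 4 is exterior iff `a, b, c > 0`. The critical point between the two smallest roots then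
  forces `v < t + 1`, so `v` is the smaller root of `G` (`NormalForm.lt_of_pos`). Conversely, for
  the smaller root both critical points of `P` are positive and the signs of `P` there produce three
  positive roots (`exists_normalForm_exterior`).
* If vortex 4 is between the others, some root is negative, hence `e < 0`, that is, `v > v₀`. As
  `G v₀` has the sign of `1 / 2 - t`, this requires `t > 1 / 2`, and `v` is the larger root of `G`
  (`NormalForm.lt_of_neg`, `NormalForm.half_lt_of_neg`). Conversely, if `t > 1 / 2`, the larger root
  gives one negative and two positive roots of `P` (`exists_normalForm_between`).

So each group of orderings has at most one admissible cubic, and an ordering determines how its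
roots and `0` are distributed among the vortices (`IsNormalized.eq_of_sorts`). Counting classes is
counting orderings, since each class has exactly one of the twelve (`exists_ordering`,
`ordering_unique`).
-/

namespace Vortex

open Complex

/-! ### The equations on a line -/

/-- Vortex 4, of circulation `m`, at the origin of a line and unit vortices at the distinct points
`a, b, c ≠ 0` rotate about the point `k` of the line with angular velocity `ω`. The last four fields
are the equations of motion of the unit vortices and of vortex 4. The equations make `k` the center
of vorticity when the total circulation is nonzero; `ω ≠ 0` is not part of the definition. -/
structure LineEquilibrium (m ω k a b c : ℝ) : Prop where
  ne_a : a ≠ 0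
  ne_b : b ≠ 0
  ne_c : c ≠ 0
  ne_ab : a ≠ b
  ne_bc : b ≠ c
  ne_ac : a ≠ c
  eq_a : 1 / (a - b) + 1 / (a - c) + m / a = ω * (a - k)
  eq_b : 1 / (b - a) + 1 / (b - c) + m / b = ω * (b - k)
  eq_c : 1 / (c - a) + 1 / (c - b) + m / c = ω * (c - k)
  eq_zero : 1 / a + 1 / b + 1 / c = ω * k

namespace LineEquilibrium

variable {m ω k a b c : ℝ}

theorem swap_ab (h : LineEquilibrium m ω k a b c) : LineEquilibrium m ω k b a c where
  ne_a := h.ne_b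
  ne_b := h.ne_a
  ne_c := h.ne_c
  ne_ab := h.ne_ab.symm
  ne_bc := h.ne_ac
  ne_ac := h.ne_bc
  eq_a := h.eq_b
  eq_b := h.eq_a
  eq_c := by rw [← h.eq_c]; ring
  eq_zero := by rw [← h.eq_zero]; ring

theorem swap_bc (h : LineEquilibrium m ω k a b c) : LineEquilibrium m ω k a c b where
  ne_a := h.ne_a
  ne_b := h.ne_c
  ne_c := h.ne_b
  ne_ab := h.ne_ac
  ne_bc := h.ne_bc.symm
  ne_ac := h.ne_ab
  eq_a := by rw [← h.eq_a]; ring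
  eq_b := h.eq_c
  eq_c := h.eq_b
  eq_zero := by rw [← h.eq_zero]; ring

theorem scale (h : LineEquilibrium m ω k a b c) {r : ℝ} (hr : r ≠ 0) :
    LineEquilibrium m (ω / r ^ 2) (r * k) (r * a) (r * b) (r * c) := by
  have key : ∀ x y : ℝ, 1 / (r * x - r * y) = 1 / r * (1 / (x - y)) := fun x y => by
    rw [← mul_sub, one_div_mul_one_div]
  have key' : ∀ y x : ℝ, y / (r * x) = 1 / r * (y / x) := fun y x => by
    rw [div_mul_div_comm, one_mul]
  have key'' : ∀ x y : ℝ, ω / r ^ 2 * (r * x - r * y) = 1 / r * (ω * (x - y)) := fun x y => by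
    field_simp
  refine ⟨mul_ne_zero hr h.ne_a, mul_ne_zero hr h.ne_b, mul_ne_zero hr h.ne_c, ?_, ?_, ?_,
    ?_, ?_, ?_, ?_⟩
  · exact fun e => h.ne_ab (mul_left_cancel₀ hr e)
  · exact fun e => h.ne_bc (mul_left_cancel₀ hr e)
  · exact fun e => h.ne_ac (mul_left_cancel₀ hr e)
  · rw [key, key, key', key'', ← h.eq_a]; ring
  · rw [key, key, key', key'', ← h.eq_b]; ring
  · rw [key, key, key', key'', ← h.eq_c]; ring
  · rw [key', key', key', ← mul_add, ← mul_add, h.eq_zero]; field_simp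

/-- Vortex 4 is not at the center of rotation: otherwise the first two elementary symmetric functions
of `a, b, c`, and hence `a ^ 2 + b ^ 2 + c ^ 2`, vanish. -/
theorem center_ne_zero (h : LineEquilibrium m ω k a b c) (hω : ω ≠ 0) : k ≠ 0 := by
  rintro rfl
  obtain ⟨ha, hb, hc, hab, hbc, hac, ea, eb, ec, e0⟩ := h
  have hab' := sub_ne_zero.2 hab
  have hba' := sub_ne_zero.2 hab.symm
  have hbc' := sub_ne_zero.2 hbc
  have hcb' := sub_ne_zero.2 hbc.symm
  have hac' := sub_ne_zero.2 hac
  have hca' := sub_ne_zero.2 hac.symm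
  have h1 : a + b + c = 0 := by
    have : (1 / (a - b) + 1 / (a - c) + m / a) + (1 / (b - a) + 1 / (b - c) + m / b)
        + (1 / (c - a) + 1 / (c - b) + m / c) = m * (1 / a + 1 / b + 1 / c) := by
      rw [← neg_sub a b, ← neg_sub b c, ← neg_sub a c]
      simp only [one_div, inv_neg]
      ring
    rw [ea, eb, ec, e0] at this
    have : ω * (a + b + c) = 0 := by linarith
    exact (mul_eq_zero.1 this).resolve_left hω
  have h2 : a * b + b * c + a * c = 0 := by
    field_simp at e0
    linarith
  have : a ^ 2 + b ^ 2 + c ^ 2 = 0 := by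
    linear_combination (a + b + c) * h1 - 2 * h2
  exact ha (pow_eq_zero_iff two_ne_zero |>.1 (by nlinarith [sq_nonneg a, sq_nonneg b, sq_nonneg c]))

/-- The difference of the equations of two unit vortices, divided by their separation. -/
theorem omega_eq_pair (h : LineEquilibrium m ω k a b c) :
    ω = 2 / (a - b) ^ 2 - 1 / ((a - c) * (b - c)) - m / (a * b) := by
  obtain ⟨ha, hb, hc, hab, hbc, hac, ea, eb, ec, e0⟩ := h
  have hab' := sub_ne_zero.2 hab
  have hbc' := sub_ne_zero.2 hbc
  have hac' := sub_ne_zero.2 hac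
  have : ω * (a - b) =
      (1 / (a - b) + 1 / (a - c) + m / a) - (1 / (b - a) + 1 / (b - c) + m / b) := by
    rw [ea, eb]; ring
  rw [← neg_sub a b, one_div_neg_eq_neg_one_div] at this
  have h2 : ω = ω * (a - b) / (a - b) := by field_simp
  rw [h2, this]
  field_simp
  ring

/-- The difference of the equations of a unit vortex and of vortex 4, divided by their separation. -/
theorem omega_eq_of_origin (h : LineEquilibrium m ω k a b c) :
    ω = (m + 1) / a ^ 2 + 1 / ((a - b) * b) + 1 / ((a - c) * c) := by
  obtain ⟨ha, hb, hc, hab, hbc, hac, ea, eb, ec, e0⟩ := h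
  have hab' := sub_ne_zero.2 hab
  have hac' := sub_ne_zero.2 hac
  have : ω * a = (1 / (a - b) + 1 / (a - c) + m / a) + (1 / a + 1 / b + 1 / c) := by
    rw [ea, e0]; ring
  have h2 : ω = ω * a / a := by field_simp
  rw [h2, this]
  field_simp
  ring

theorem false_of_pos (h : LineEquilibrium m ω k a b c) (hm : m ≤ -1) (ha : 0 < a) (hab : a < b)
    (hbc : b < c) : False := by
  have h1 : ω < 0 := by
    rw [h.omega_eq_of_origin]
    have e1 : (m + 1) / a ^ 2 ≤ 0 := div_nonpos_of_nonpos_of_nonneg (by linarith) (sq_nonneg a)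
    have e2 : 1 / ((a - b) * b) < 0 :=
      one_div_neg.2 (mul_neg_of_neg_of_pos (by linarith) (by linarith))
    have e3 : 1 / ((a - c) * c) < 0 :=
      one_div_neg.2 (mul_neg_of_neg_of_pos (by linarith) (by linarith))
    linarith
  have h2 : 0 < ω := by
    rw [h.swap_bc.omega_eq_pair]
    have e1 : 0 < 2 / (a - c) ^ 2 := div_pos two_pos (sq_pos_of_neg (by linarith))
    have e2 : 1 / ((a - b) * (c - b)) < 0 :=
      one_div_neg.2 (mul_neg_of_neg_of_pos (by linarith) (by linarith))
    have e3 : m / (a * c) < 0 := div_neg_of_neg_of_pos (by linarith) (mul_pos ha (by linarith))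
    linarith
  linarith

theorem false_of_between (h : LineEquilibrium m ω k a b c) (hm : m ≤ -1) (ha : a < 0) (hb : 0 < b)
    (hbc : b < c) : False := by
  have h1 : ω < 0 := by
    rw [h.omega_eq_of_origin]
    have e1 : (m + 1) / a ^ 2 ≤ 0 := div_nonpos_of_nonpos_of_nonneg (by linarith) (sq_nonneg a)
    have e2 : 1 / ((a - b) * b) < 0 :=
      one_div_neg.2 (mul_neg_of_neg_of_pos (by linarith) (by linarith))
    have e3 : 1 / ((a - c) * c) < 0 :=
      one_div_neg.2 (mul_neg_of_neg_of_pos (by linarith) (by linarith))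
    linarith
  have h2 : 0 < ω := by
    rw [h.swap_ab.swap_bc.omega_eq_pair]
    have hc : 0 < c := by linarith
    have hbc' : 0 < b * c := mul_pos hb hc
    have e1 : 0 ≤ 2 / (b - c) ^ 2 := by positivity
    have e2 : 1 / ((b - a) * (c - a)) < 1 / (b * c) :=
      one_div_lt_one_div_of_lt hbc' (by nlinarith)
    have e3 : m / (b * c) ≤ -(1 / (b * c)) := by
      rw [← neg_div]; exact (div_le_div_iff_of_pos_right hbc').2 hm
    linarith
  linarith

theorem false_of_lt (h : LineEquilibrium m ω k a b c) (hm : m ≤ -1) (hab : a < b)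
    (hbc : b < c) : False := by
  have hn := h.scale (r := -1) (by norm_num)
  rcases h.ne_a.lt_or_gt with ha | ha
  · rcases h.ne_b.lt_or_gt with hb | hb
    · rcases h.ne_c.lt_or_gt with hc | hc
      · exact hn.swap_ab.swap_bc.swap_ab.false_of_pos hm (by linarith) (by linarith) (by linarith)
      · exact hn.swap_ab.swap_bc.swap_ab.false_of_between hm (by linarith) (by linarith)
          (by linarith)
    · exact h.false_of_between hm ha hb hbc
  · exact h.false_of_pos hm ha hab hbc

/-- There is no equilibrium on a line, for any `ω`, if `m ≤ -1`. -/
theorem neg_one_lt (h : LineEquilibrium m ω k a b c) : -1 < m := by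
  by_contra! hm
  rcases h.ne_ab.lt_or_gt with hab | hab <;> rcases h.ne_bc.lt_or_gt with hbc | hbc <;>
    rcases h.ne_ac.lt_or_gt with hac | hac
  · exact h.false_of_lt hm hab hbc
  · linarith
  · exact h.swap_bc.false_of_lt hm hac hbc
  · exact h.swap_bc.swap_ab.false_of_lt hm hac hab
  · exact h.swap_ab.false_of_lt hm hab hac
  · exact h.swap_ab.swap_bc.false_of_lt hm hbc hac
  · linarith
  · exact h.swap_ab.swap_bc.swap_ab.false_of_lt hm hbc hab

end LineEquilibrium

/-! ### The normal form -/

/-- The quadratic in `v = 1 / ω` whose roots are the possible values of `v` when vortex 4 is at `0`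
and the center of vorticity is at `1`; here `t = m + 1`. -/
noncomputable def periodQuadratic (t v : ℝ) : ℝ :=
  9 * t * v ^ 2 - (10 * t ^ 2 + 15 * t + 2) * v + t * (t + 1) * (t + 2)

/-- The value of the second elementary symmetric function of the positions of the unit vortices, in
terms of `t = m + 1` and `v = 1 / ω`. -/
noncomputable def pairSum (t v : ℝ) : ℝ := ((t + 1) * (t + 2) - 3 * t * v) / 2

/-- The monic cubic whose roots are the positions of the unit vortices. -/
noncomputable def cubic (t v x : ℝ) : ℝ :=
  x ^ 3 - (t + 2) * x ^ 2 + pairSum t v * x - pairSum t v * v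

/-- The positions `a, b, c` of the unit vortices, with vortex 4 at `0` and the center of vorticity at
`1`, are the three roots of `cubic t v` for a root `v` of the quadratic; `t = m + 1`, `v = 1 / ω`.
That `a, b, c` are distinct and nonzero is not included. -/
structure NormalForm (t v a b c : ℝ) : Prop where
  quad : periodQuadratic t v = 0
  factor : ∀ x, (x - a) * (x - b) * (x - c) = cubic t v x

namespace NormalForm

variable {t v a b c : ℝ}

theorem sum (h : NormalForm t v a b c) : a + b + c = t + 2 := by
  have h1 := h.factor 1
  have h2 := h.factor (-1)
  have h0 := h.factor 0
  unfold cubic at h0 h1 h2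
  linarith

theorem pair (h : NormalForm t v a b c) : a * b + b * c + a * c = pairSum t v := by
  have h1 := h.factor 1
  have h2 := h.factor (-1)
  unfold cubic at h1 h2
  linarith

theorem prod (h : NormalForm t v a b c) : a * b * c = pairSum t v * v := by
  have h0 := h.factor 0
  unfold cubic at h0
  linarith

end NormalForm

/-- The symmetric functions are found from the sums of the equations of the unit vortices weighted by
`1`, by `a, b, c`, and by `1 / a, 1 / b, 1 / c`, together with the equation of vortex 4. -/
theorem LineEquilibrium.normalForm {m ω a b c : ℝ} (h : LineEquilibrium m ω 1 a b c)
    (hω : ω ≠ 0) : NormalForm (m + 1) ω⁻¹ a b c := by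
  obtain ⟨ha, hb, hc, hab, hbc, hac, ea, eb, ec, e0⟩ := h
  have hab' := sub_ne_zero.2 hab
  have hbc' := sub_ne_zero.2 hbc
  have hac' := sub_ne_zero.2 hac
  rw [← neg_sub a b, one_div_neg_eq_neg_one_div] at eb
  rw [← neg_sub a c, ← neg_sub b c, one_div_neg_eq_neg_one_div, one_div_neg_eq_neg_one_div] at ec
  obtain ⟨v, rfl⟩ : ∃ v, ω = v⁻¹ := ⟨ω⁻¹, (inv_inv ω).symm⟩
  have hv : v ≠ 0 := by rintro rfl; simp at hω
  rw [inv_inv]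
  have hsum : a + b + c = m + 1 + 2 := by
    have : m * (1 / a + 1 / b + 1 / c) = v⁻¹ * (a + b + c - 3) := by
      linear_combination ea + eb + ec
    rw [e0] at this
    field_simp at this
    linarith
  have hprod : a * b * c = (a * b + b * c + a * c) * v := by
    field_simp at e0
    linarith
  have hpair : 2 * (a * b + b * c + a * c) = (m + 1 + 1) * (m + 1 + 2) - 3 * (m + 1) * v := by
    have h1 : a * (1 / (a - b) + 1 / (a - c) + m / a) + b * (-(1 / (a - b)) + 1 / (b - c) + m / b)
        + c * (-(1 / (a - c)) + -(1 / (b - c)) + m / c) = 3 + 3 * m := by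
      field_simp
      ring
    rw [ea, eb, ec] at h1
    have h2 : a * (a - 1) + b * (b - 1) + c * (c - 1) = 3 * (m + 1) * v := by
      field_simp at h1
      linarith
    linear_combination (a + b + c + m + 1 + 2 - 1) * hsum - h2
  refine ⟨?_, fun x => ?_⟩
  swap
  · unfold cubic pairSum
    linear_combination -x ^ 2 * hsum + (x - v) / 2 * hpair - hprod
  have h1 : 1 / a * (1 / (a - b) + 1 / (a - c) + m / a)
      + 1 / b * (-(1 / (a - b)) + 1 / (b - c) + m / b)
      + 1 / c * (-(1 / (a - c)) + -(1 / (b - c)) + m / c)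
      = m * (1 / a + 1 / b + 1 / c) ^ 2 - (2 * m + 1) * (a + b + c) / (a * b * c) := by
    field_simp
    ring
  have h2 : 1 / a * (v⁻¹ * (a - 1)) + 1 / b * (v⁻¹ * (b - 1)) + 1 / c * (v⁻¹ * (c - 1))
      = v⁻¹ * (3 - (1 / a + 1 / b + 1 / c)) := by
    field_simp
    ring
  rw [ea, eb, ec, h2, e0, hsum] at h1
  set e3 := a * b * c with he3
  have he3' : e3 ≠ 0 := mul_ne_zero (mul_ne_zero ha hb) hc
  field_simp at h1
  rw [hprod] at h1
  set e2 := a * b + b * c + a * c with he2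
  have h3 : (m + 1) * e2 - (2 * m + 1) * (m + 3) * v = 3 * v * e2 := by
    apply mul_left_cancel₀ hv
    linear_combination -h1
  unfold periodQuadratic
  linear_combination 2 * h3 + (3 * v - (m + 1)) * hpair

/-- The second order differential equation of `P = cubic t v`; the factors `3 * x - (t + 2)` and
`3 * x ^ 2 - 2 * (t + 2) * x + pairSum t v` are `P'' / 2` and `P'`. -/
theorem cubic_ode {t v : ℝ} (h : periodQuadratic t v = 0) (x : ℝ) :
    v * x * (3 * x - (t + 2))
      + ((t - 1) * v - x * (x - 1)) * (3 * x ^ 2 - 2 * (t + 2) * x + pairSum t v)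
      + (3 * x + t - 1) * cubic t v x = 0 := by
  unfold periodQuadratic at h
  unfold cubic pairSum
  linear_combination x / 2 * h

theorem cubic_factor {t v a b c : ℝ} (hab : a ≠ b) (hbc : b ≠ c) (hac : a ≠ c)
    (ha : cubic t v a = 0) (hb : cubic t v b = 0) (hc : cubic t v c = 0) (x : ℝ) :
    (x - a) * (x - b) * (x - c) = cubic t v x := by
  unfold cubic at *
  set e := pairSum t v
  have h1 : a ^ 2 + a * b + b ^ 2 - (t + 2) * (a + b) + e = 0 := by
    apply mul_left_cancel₀ (sub_ne_zero.2 hab)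
    linear_combination ha - hb
  have h2 : a ^ 2 + a * c + c ^ 2 - (t + 2) * (a + c) + e = 0 := by
    apply mul_left_cancel₀ (sub_ne_zero.2 hac)
    linear_combination ha - hc
  have h3 : a + b + c - (t + 2) = 0 := by
    apply mul_left_cancel₀ (sub_ne_zero.2 hbc)
    linear_combination h1 - h2
  linear_combination -(x ^ 2 - a ^ 2 - (x - a) * (a + b)) * h3 - (x - a) * h1 - ha

namespace NormalForm

variable {t v a b c : ℝ}

/-- The differential equation of the cubic at a root; it is the cleared equation of motion. -/
theorem root_equation (h : NormalForm t v a b c) :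
    v * a * ((a - b) + (a - c)) + ((t - 1) * v - a * (a - 1)) * ((a - b) * (a - c)) = 0 := by
  have h0 := cubic_ode h.quad a
  rw [← h.factor a, ← h.sum, ← h.pair] at h0
  linear_combination h0

theorem swap_ab (h : NormalForm t v a b c) : NormalForm t v b a c :=
  ⟨h.quad, fun x => by rw [← h.factor]; ring⟩

theorem swap_bc (h : NormalForm t v a b c) : NormalForm t v a c b :=
  ⟨h.quad, fun x => by rw [← h.factor]; ring⟩

theorem eq_at_root (h : NormalForm t v a b c) (hv : v ≠ 0) (ha : a ≠ 0) (hab : a ≠ b)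
    (hac : a ≠ c) : 1 / (a - b) + 1 / (a - c) + (t - 1) / a = v⁻¹ * (a - 1) := by
  have hab' := sub_ne_zero.2 hab
  have hac' := sub_ne_zero.2 hac
  have := h.root_equation
  field_simp
  linear_combination this

/-- Converse of `LineEquilibrium.normalForm`. -/
theorem lineEquilibrium (h : NormalForm t v a b c) (hv : v ≠ 0) (ha : a ≠ 0) (hb : b ≠ 0)
    (hc : c ≠ 0) (hab : a ≠ b) (hbc : b ≠ c) (hac : a ≠ c) :
    LineEquilibrium (t - 1) v⁻¹ 1 a b c where
  ne_a := ha
  ne_b := hb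
  ne_c := hc
  ne_ab := hab
  ne_bc := hbc
  ne_ac := hac
  eq_a := h.eq_at_root hv ha hab hac
  eq_b := h.swap_ab.eq_at_root hv hb hab.symm hbc
  eq_c := h.swap_bc.swap_ab.eq_at_root hv hc hac.symm hbc.symm
  eq_zero := by
    have := h.prod
    rw [← h.pair] at this
    field_simp
    linear_combination -this

end NormalForm

/-! ### Roots of the quadratic -/

section Quadratic

variable {t v w : ℝ}

theorem periodQuadratic_mid (t : ℝ) : periodQuadratic t (t + 1) = -((t + 1) * (4 * t + 2)) := by
  unfold periodQuadratic; ring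

/-- The value of the quadratic at the point where `pairSum t` vanishes. -/
theorem periodQuadratic_pairSum_zero (ht : t ≠ 0) :
    periodQuadratic t ((t + 1) * (t + 2) / (3 * t)) =
      -((4 * t - 2) * (t + 2) * ((t + 1) * (t + 2) / (3 * t))) := by
  unfold periodQuadratic; field_simp; ring

theorem periodQuadratic_chord (t u v w : ℝ) : (v - w) * periodQuadratic t u =
    (v - u) * periodQuadratic t w + (u - w) * periodQuadratic t v
      - 9 * t * ((v - u) * (u - w) * (v - w)) := by
  unfold periodQuadratic; ring

/-- Convexity of the quadratic in `v`. -/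
theorem periodQuadratic_neg_of_between (ht : 0 < t) {u : ℝ} (hw : periodQuadratic t w < 0)
    (hv : periodQuadratic t v ≤ 0) (hwu : w ≤ u) (huv : u < v) : periodQuadratic t u < 0 := by
  have h := periodQuadratic_chord t u v w
  have h1 : (v - u) * periodQuadratic t w < 0 := mul_neg_of_pos_of_neg (by linarith) hw
  have h2 : (u - w) * periodQuadratic t v ≤ 0 := mul_nonpos_of_nonneg_of_nonpos (by linarith) hv
  have h3 : 0 ≤ 9 * t * ((v - u) * (u - w) * (v - w)) :=
    mul_nonneg (by linarith) (mul_nonneg (mul_nonneg (by linarith) (by linarith)) (by linarith))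
  have h4 : (v - w) * periodQuadratic t u < 0 := by linarith
  exact (pos_iff_neg_of_mul_neg h4).1 (by linarith)

theorem periodQuadratic_root_pos (ht : 0 < t) (h : periodQuadratic t v = 0) : 0 < v := by
  by_contra! hv
  have h1 : 0 ≤ 9 * t * v ^ 2 := by positivity
  have h2 : 0 ≤ (10 * t ^ 2 + 15 * t + 2) * (-v) := mul_nonneg (by positivity) (by linarith)
  have h3 : 0 < t * (t + 1) * (t + 2) := by positivity
  unfold periodQuadratic at h
  linarith

/-- Two roots on the same side of a point where the quadratic is negative coincide. -/
theorem periodQuadratic_root_unique (ht : 0 < t) {v' : ℝ} (h : periodQuadratic t v = 0)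
    (h' : periodQuadratic t v' = 0) (hw : periodQuadratic t w < 0)
    (hs : 0 ≤ (w - v) * (w - v')) : v = v' := by
  by_contra hne
  unfold periodQuadratic at *
  have h1 : 9 * t * (v + v') - (10 * t ^ 2 + 15 * t + 2) = 0 := by
    apply mul_left_cancel₀ (sub_ne_zero.2 hne)
    linear_combination h - h'
  have h2 : 0 ≤ 9 * t * ((w - v) * (w - v')) := mul_nonneg (by linarith) hs
  have h3 : 9 * t * w ^ 2 - (10 * t ^ 2 + 15 * t + 2) * w + t * (t + 1) * (t + 2) =
      9 * t * ((w - v) * (w - v')) := by linear_combination h + (w - v) * h1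
  linarith

end Quadratic

/-! ### The position of vortex 4 and the root of the quadratic -/

namespace NormalForm

variable {t v a b c : ℝ}

theorem v_pos (h : NormalForm t v a b c) (ht : 0 < t) : 0 < v :=
  periodQuadratic_root_pos ht h.quad

/-- For `t < 1` the claim follows from the critical point `x` of the cubic `P` in `(a, b)`. There
`P > 0` and `P'' < 0`, so the differential equation gives `x > (1 - t) / 3`. Hence
`P' ((1 - t) / 3) > 0`, which is the inequality `v < t + 1`. -/
theorem lt_of_sorted (h : NormalForm t v a b c) (ht : 0 < t) (ha : 0 < a) (hab : a < b)
    (hbc : b < c) : v < t + 1 := by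
  have hv := h.v_pos ht
  have hb : 0 < b := ha.trans hab
  have hc : 0 < c := hb.trans hbc
  have he : 0 < pairSum t v := by rw [← h.pair]; positivity
  rcases le_or_gt 1 t with ht1 | ht1
  · unfold pairSum at he
    by_contra! hvt
    nlinarith
  have hsum := h.sum
  have hpair := h.pair
  obtain ⟨x, ⟨hax, hxb⟩, hx⟩ : ∃ x ∈ Set.Ioo a b,
      3 * x ^ 2 - 2 * (t + 2) * x + pairSum t v = 0 := by
    apply intermediate_value_Ioo' hab.le (f := fun x => 3 * x ^ 2 - 2 * (t + 2) * x + pairSum t v)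
      (by fun_prop)
    constructor
    · have : 0 < (b - a) * (c - a) := mul_pos (by linarith) (by linarith)
      show 3 * b ^ 2 - 2 * (t + 2) * b + pairSum t v < 0
      have : 0 < (b - a) * (c - b) := mul_pos (by linarith) (by linarith)
      rw [← hsum, ← hpair]
      linarith
    · have : 0 < (b - a) * (c - a) := mul_pos (by linarith) (by linarith)
      show 0 < 3 * a ^ 2 - 2 * (t + 2) * a + pairSum t v
      rw [← hsum, ← hpair]
      linarith
  have hode := cubic_ode h.quad x
  rw [hx, mul_zero, add_zero, ← h.factor] at hode
  have hP : 0 < (x - a) * (x - b) * (x - c) :=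
    mul_pos_of_neg_of_neg (mul_neg_of_pos_of_neg (by linarith) (by linarith)) (by linarith)
  -- `x` is closer to `a` than to `b`, so the sum of its signed distances to the roots is negative
  have hcurv : 3 * x - (t + 2) < 0 := by
    have h1 : (b - x) * (c - x) = (x - a) * ((b - x) + (c - x)) := by
      rw [← hsum, ← hpair] at hx
      linarith
    have h2 : (x - a) * (c - x) < (b - x) * (c - x) := by
      rw [h1]
      have : 0 < (x - a) * (b - x) := mul_pos (by linarith) (by linarith)
      linarith
    have h3 : x - a < b - x := lt_of_mul_lt_mul_right h2 (by linarith)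
    linarith
  have hx3 : 0 < 3 * x + t - 1 := by
    have h1 : v * x * (3 * x - (t + 2)) < 0 :=
      mul_neg_of_pos_of_neg (mul_pos hv (ha.trans hax)) hcurv
    have h2 : 0 < (3 * x + t - 1) * ((x - a) * (x - b) * (x - c)) := by linarith
    exact (pos_iff_pos_of_mul_pos h2).2 hP
  -- this product is the difference of the values of `P'` at `(1 - t) / 3` and at its zero `x`
  have hy : 0 < ((1 - t) / 3 - x) * ((1 - t) + 3 * x - 2 * (t + 2)) :=
    mul_pos_of_neg_of_neg (by linarith) (by linarith)
  unfold pairSum at hx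
  by_contra! hvt
  nlinarith

theorem lt_of_pos (h : NormalForm t v a b c) (ht : 0 < t) (ha : 0 < a) (hb : 0 < b) (hc : 0 < c)
    (hab : a ≠ b) (hbc : b ≠ c) (hac : a ≠ c) : v < t + 1 := by
  rcases hab.lt_or_gt with hab | hab <;> rcases hbc.lt_or_gt with hbc | hbc <;>
    rcases hac.lt_or_gt with hac | hac
  · exact h.lt_of_sorted ht ha hab hbc
  · linarith
  · exact h.swap_bc.lt_of_sorted ht ha hac hbc
  · exact h.swap_bc.swap_ab.lt_of_sorted ht hc hac hab
  · exact h.swap_ab.lt_of_sorted ht hb hab hac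
  · exact h.swap_ab.swap_bc.lt_of_sorted ht hb hbc hac
  · linarith
  · exact h.swap_ab.swap_bc.swap_ab.lt_of_sorted ht hc hbc hab

/-- A negative position forces `pairSum t v < 0`: otherwise the cubic is negative on `(-∞, 0)`. -/
theorem lt_of_neg (h : NormalForm t v a b c) (ht : 0 < t) (ha : a < 0) :
    (t + 1) * (t + 2) / (3 * t) < v := by
  have hv := h.v_pos ht
  by_contra! hle
  rw [le_div_iff₀ (by positivity)] at hle
  have he : 0 ≤ pairSum t v := by unfold pairSum; linarith
  have h0 := h.factor a
  rw [sub_self, zero_mul, zero_mul] at h0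
  unfold cubic at h0
  have h1 : 0 < (t + 2) * a ^ 2 := mul_pos (by linarith) (sq_pos_of_neg ha)
  have h2 : 0 ≤ pairSum t v * (v - a) := mul_nonneg he (by linarith)
  have h3 : a ^ 3 < 0 := by
    have := pow_pos (neg_pos.2 ha) 3
    linarith
  linarith

theorem half_lt_of_neg (h : NormalForm t v a b c) (ht : 0 < t) (ha : a < 0) : 1 / 2 < t := by
  by_contra! hle
  have hlt := h.lt_of_neg ht ha
  have h1 : periodQuadratic t ((t + 1) * (t + 2) / (3 * t)) < 0 := by
    refine periodQuadratic_neg_of_between ht (w := t + 1) ?_ h.quad.le ?_ hlt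
    · rw [periodQuadratic_mid, neg_lt_zero]; positivity
    · rw [le_div_iff₀ (by positivity)]; nlinarith
  rw [periodQuadratic_pairSum_zero ht.ne', neg_lt_zero] at h1
  have h2 : (4 * t - 2) * (t + 2) * ((t + 1) * (t + 2) / (3 * t)) ≤ 0 :=
    mul_nonpos_of_nonpos_of_nonneg
      (mul_nonpos_of_nonpos_of_nonneg (by linarith) (by linarith)) (by positivity)
  linarith

end NormalForm

/-! ### Existence -/

theorem cubic_continuous (t v : ℝ) : Continuous (cubic t v) := by
  unfold cubic; fun_prop

theorem exists_normalForm_of_signs {t v p q r s : ℝ} (h : periodQuadratic t v = 0)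
    (hpq : p < q) (hqr : q < r) (hrs : r < s) (hp : cubic t v p < 0) (hq : 0 < cubic t v q)
    (hr : cubic t v r < 0) (hs : 0 < cubic t v s) :
    ∃ a b c, p < a ∧ a < q ∧ q < b ∧ b < r ∧ r < c ∧ NormalForm t v a b c := by
  obtain ⟨a, ⟨h1, h2⟩, ha⟩ := intermediate_value_Ioo hpq.le
    (cubic_continuous t v).continuousOn ⟨hp, hq⟩
  obtain ⟨b, ⟨h3, h4⟩, hb⟩ := intermediate_value_Ioo' hqr.le
    (cubic_continuous t v).continuousOn ⟨hr, hq⟩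
  obtain ⟨c, ⟨h5, h6⟩, hc⟩ := intermediate_value_Ioo hrs.le
    (cubic_continuous t v).continuousOn ⟨hr, hs⟩
  exact ⟨a, b, c, h1, h2, h3, h4, h5, h, cubic_factor (by linarith) (by linarith) (by linarith)
    ha hb hc⟩

/-- The differential equation at the critical points `(t + 2 + σ) / 3` of the cubic, where `σ` is either
square root of `(t + 2) ^ 2 - 3 * pairSum t v`. -/
theorem cubic_at_critical {t v σ : ℝ} (h : periodQuadratic t v = 0)
    (hσ : σ ^ 2 = (t + 2) ^ 2 - 3 * pairSum t v) :
    v * ((t + 2 + σ) / 3) * σ + (2 * t + 1 + σ) * cubic t v ((t + 2 + σ) / 3) = 0 := by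
  have h0 := cubic_ode h ((t + 2 + σ) / 3)
  have h1 : 3 * ((t + 2 + σ) / 3) ^ 2 - 2 * (t + 2) * ((t + 2 + σ) / 3) + pairSum t v = 0 := by
    linear_combination hσ / 3
  rw [h1, mul_zero, add_zero] at h0
  linear_combination h0

/-- The smaller root of the quadratic satisfies the inequalities which make both critical points of
the cubic real and positive. -/
theorem exists_small_root {t : ℝ} (ht : 0 < t) : ∃ v, periodQuadratic t v = 0 ∧ 0 < v ∧
    v < t + 1 ∧ 0 < pairSum t v ∧ 3 * pairSum t v < (t + 2) ^ 2 := by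
  have hmid : periodQuadratic t (t + 1) < 0 := by
    rw [periodQuadratic_mid, neg_lt_zero]; positivity
  have hcont : Continuous (periodQuadratic t) := by unfold periodQuadratic; fun_prop
  rcases le_or_gt t 1 with ht1 | ht1
  · obtain ⟨v, ⟨h1, h2⟩, h3⟩ := intermediate_value_Ioo' (show (0 : ℝ) ≤ t + 1 by linarith)
      hcont.continuousOn ⟨hmid, show 0 < periodQuadratic t 0 by
        unfold periodQuadratic; norm_num; positivity⟩
    have : 0 < t * v := mul_pos ht h1
    refine ⟨v, h3, h1, h2, ?_, ?_⟩ <;> unfold pairSum <;> nlinarith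
  -- `(t + 2) * (t - 1) / (9 * t)` is the value of `v` for which `3 * pairSum t v = (t + 2) ^ 2`
  · have hv1 : 0 < (t + 2) * (t - 1) / (9 * t) :=
      div_pos (mul_pos (by linarith) (by linarith)) (by linarith)
    have hlt : (t + 2) * (t - 1) / (9 * t) < t + 1 := by
      rw [div_lt_iff₀ (by linarith)]; nlinarith
    have hq : periodQuadratic t ((t + 2) * (t - 1) / (9 * t)) =
        2 * (t + 2) ^ 2 * (2 * t + 1) / (9 * t) := by
      unfold periodQuadratic; field_simp; ring
    obtain ⟨v, ⟨h1, h2⟩, h3⟩ := intermediate_value_Ioo' hlt.le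
      hcont.continuousOn ⟨hmid, by rw [hq]; positivity⟩
    refine ⟨v, h3, hv1.trans h1, h2, ?_, ?_⟩
    · by_contra! he
      have hle : (t + 1) * (t + 2) / (3 * t) ≤ v := by
        rw [div_le_iff₀ (by linarith)]; unfold pairSum at he; linarith
      have h0 : periodQuadratic t ((t + 1) * (t + 2) / (3 * t)) < 0 := by
        rw [periodQuadratic_pairSum_zero ht.ne', neg_lt_zero]
        exact mul_pos (mul_pos (by linarith) (by linarith)) (by positivity)
      exact (periodQuadratic_neg_of_between ht h0 hmid.le hle h2).ne h3
    · rw [div_lt_iff₀ (by linarith)] at h1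
      unfold pairSum; nlinarith

theorem exists_normalForm_exterior {t : ℝ} (ht : 0 < t) :
    ∃ v a b c, 0 < a ∧ a < b ∧ b < c ∧ NormalForm t v a b c := by
  obtain ⟨v, h, hv, hvt, he, hD⟩ := exists_small_root ht
  obtain ⟨σ, hσ, hσ2⟩ : ∃ σ : ℝ, 0 < σ ∧ σ ^ 2 = (t + 2) ^ 2 - 3 * pairSum t v :=
    ⟨√((t + 2) ^ 2 - 3 * pairSum t v), Real.sqrt_pos.2 (by linarith), Real.sq_sqrt (by linarith)⟩
  have h1 : σ < t + 2 := lt_of_pow_lt_pow_left₀ 2 (by linarith) (by linarith)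
  have h2 : σ < 2 * t + 1 := by
    refine lt_of_pow_lt_pow_left₀ 2 (by linarith) ?_
    rw [hσ2]; unfold pairSum; nlinarith
  have hq := cubic_at_critical h (σ := -σ) (by rw [neg_sq, hσ2])
  have hr := cubic_at_critical h hσ2
  have hq' : 0 < cubic t v ((t + 2 + -σ) / 3) := by
    have : 0 < v * ((t + 2 + -σ) / 3) * σ := mul_pos (mul_pos hv (by linarith)) hσ
    refine pos_of_mul_pos_right (a := 2 * t + 1 + -σ) ?_ (by linarith)
    linarith
  have hr' : cubic t v ((t + 2 + σ) / 3) < 0 := by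
    have : 0 < v * ((t + 2 + σ) / 3) * σ := by positivity
    refine (pos_iff_neg_of_mul_neg (a := 2 * t + 1 + σ) ?_).1 (by linarith)
    linarith
  have hp : cubic t v 0 < 0 := by
    unfold cubic
    have := mul_pos he hv
    linarith
  have hs : 0 < cubic t v (t + 2 + v) := by
    have : cubic t v (t + 2 + v) = (t + 2 + v) ^ 2 * v + pairSum t v * (t + 2) := by
      unfold cubic; ring
    rw [this]; positivity
  obtain ⟨a, b, c, k1, k2, k3, k4, k5, hn⟩ := exists_normalForm_of_signs h (by linarith)
    (by linarith) (by linarith) hp hq' hr' hs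
  exact ⟨v, a, b, c, k1, by linarith, by linarith, hn⟩

/-- The larger root of the quadratic. -/
theorem exists_large_root {t : ℝ} (ht : 1 / 2 < t) : ∃ v, periodQuadratic t v = 0 ∧ 0 < v ∧
    pairSum t v < 0 := by
  have ht0 : 0 < t := by linarith
  -- at the right end point, the sum of the roots, the quadratic has the same value as at `0`
  have hlt : (t + 1) * (t + 2) / (3 * t) < (10 * t ^ 2 + 15 * t + 2) / (9 * t) := by
    rw [div_lt_div_iff₀ (by linarith) (by linarith)]; nlinarith [mul_pos ht0 ht0]
  have h0 : periodQuadratic t ((t + 1) * (t + 2) / (3 * t)) < 0 := by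
    rw [periodQuadratic_pairSum_zero ht0.ne', neg_lt_zero]
    exact mul_pos (mul_pos (by linarith) (by linarith)) (by positivity)
  have h1 : 0 < periodQuadratic t ((10 * t ^ 2 + 15 * t + 2) / (9 * t)) := by
    have : periodQuadratic t ((10 * t ^ 2 + 15 * t + 2) / (9 * t)) = t * (t + 1) * (t + 2) := by
      unfold periodQuadratic; field_simp; ring
    rw [this]; positivity
  obtain ⟨v, ⟨k1, k2⟩, k3⟩ := intermediate_value_Ioo hlt.le
    (f := periodQuadratic t) (by unfold periodQuadratic; fun_prop) ⟨h0, h1⟩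
  refine ⟨v, k3, lt_trans (by positivity) k1, ?_⟩
  rw [div_lt_iff₀ (by linarith)] at k1
  unfold pairSum
  linarith

theorem exists_normalForm_between {t : ℝ} (ht : 1 / 2 < t) :
    ∃ v a b c, a < 0 ∧ 0 < b ∧ b < c ∧ NormalForm t v a b c := by
  obtain ⟨v, h, hv, he⟩ := exists_large_root ht
  have hD : 0 < (t + 2) ^ 2 - 3 * pairSum t v := by nlinarith
  obtain ⟨σ, hσ, hσ2⟩ : ∃ σ : ℝ, 0 < σ ∧ σ ^ 2 = (t + 2) ^ 2 - 3 * pairSum t v :=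
    ⟨√((t + 2) ^ 2 - 3 * pairSum t v), Real.sqrt_pos.2 hD, Real.sq_sqrt hD.le⟩
  have hr := cubic_at_critical h hσ2
  have hr' : cubic t v ((t + 2 + σ) / 3) < 0 := by
    have : 0 < v * ((t + 2 + σ) / 3) * σ := by positivity
    refine (pos_iff_neg_of_mul_neg (a := 2 * t + 1 + σ) ?_).1 (by linarith)
    linarith
  have hq : 0 < cubic t v 0 := by
    unfold cubic
    have := mul_neg_of_neg_of_pos he hv
    linarith
  set e := pairSum t v with hedef
  have hp : cubic t v (-(1 + v - e)) < 0 := by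
    have h1 : cubic t v (-(1 + v - e)) = -((1 + v - e) * ((1 + v - e) ^ 2 + 2 * e))
        - (t + 2) * (1 + v - e) ^ 2 - (-e) * (1 - e) := by
      unfold cubic; rw [← hedef]; ring
    have h2 : 0 < (1 + v - e) := by linarith
    have h3 : 0 < (1 + v - e) ^ 2 + 2 * e := by nlinarith
    have h4 : 0 < (1 + v - e) * ((1 + v - e) ^ 2 + 2 * e) := mul_pos h2 h3
    have h5 : 0 < (-e) * (1 - e) := mul_pos (by linarith) (by linarith)
    have h6 : 0 < (t + 2) * (1 + v - e) ^ 2 := mul_pos (by linarith) (by positivity)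
    rw [h1]; linarith
  have hs : 0 < cubic t v (t + 2 + σ + 1 - e) := by
    set x := t + 2 + σ + 1 - e with hx
    have h1 : cubic t v x = x * (x * (σ + 1) + (-e) * (x - 1)) + (-e) * v := by
      unfold cubic; rw [← hedef, hx]; ring
    have h2 : 0 < x := by linarith
    have h3 : 0 < (-e) * (x - 1) := mul_pos (by linarith) (by linarith)
    have h4 : 0 < (-e) * v := mul_pos (by linarith) hv
    rw [h1]; positivity
  obtain ⟨a, b, c, k1, k2, k3, k4, k5, hn⟩ := exists_normalForm_of_signs h (by linarith)
    (by linarith) (by linarith) hp hq hr' hs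
  exact ⟨v, a, b, c, k2, k3, by linarith, hn⟩

/-! ### Relative equilibria and the equations on a line -/

theorem velocity_rotate {n : ℕ} (Γ : Fin n → ℝ) (z : Config n) (c : ℂ) (ω t : ℝ) (i : Fin n) :
    velocity Γ (rotate ω c z t) i = exp ((ω * t : ℝ) * I) * velocity Γ z i := by
  have he : ‖exp ((ω * t : ℝ) * I)‖ = 1 := norm_exp_ofReal_mul_I _
  have hsub : ∀ j k, rotate ω c z t j - rotate ω c z t k =
      exp ((ω * t : ℝ) * I) * (z j - z k) := fun j k => by unfold rotate; ring
  simp only [velocity, hsub, norm_mul, he, one_mul, Finset.mul_sum]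
  exact Finset.sum_congr rfl fun j _ => by ring

theorem isSolution_rotate_iff {n : ℕ} (Γ : Fin n → ℝ) (z : Config n) (c : ℂ) (ω : ℝ) :
    IsSolution Γ (rotate ω c z) ↔
      Function.Injective z ∧ ∀ i, I * ω * (z i - c) = velocity Γ z i := by
  have hd : ∀ (t : ℝ) (i : Fin n), HasDerivAt (fun s => rotate ω c z s i)
      (exp ((ω * t : ℝ) * I) * (I * ω * (z i - c))) t := fun t i => by
    have h1 : HasDerivAt (fun s : ℝ => ((ω * s : ℝ) : ℂ) * I) (ω * I) t := by
      have := ((hasDerivAt_id t).const_mul ω).ofReal_comp.mul_const I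
      simpa using this
    have h2 := (h1.cexp.mul_const (z i - c)).const_add c
    have h3 : exp ((ω * t : ℝ) * I) * (I * ω * (z i - c)) =
        exp ((ω * t : ℝ) * I) * (ω * I) * (z i - c) := by ring
    rw [h3]
    exact h2
  constructor
  · intro h
    have h0 : rotate ω c z 0 = z := by funext i; simp [rotate]
    refine ⟨h0 ▸ (h 0).1, fun i => ?_⟩
    have := (hd 0 i).unique ((h 0).2 i)
    rw [velocity_rotate] at this
    exact mul_left_cancel₀ (exp_ne_zero _) this
  · rintro ⟨hinj, h⟩ t
    refine ⟨fun i j hij => hinj ?_, fun i => ?_⟩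
    · unfold rotate at hij
      have := mul_left_cancel₀ (exp_ne_zero _) (add_left_cancel hij)
      exact sub_left_injective this
    · rw [velocity_rotate, ← h i]
      exact hd t i

/-- In the sum on the right the term `j = i` is `Γ i / 0 = 0`, so the sum runs over `j ≠ i`. -/
theorem velocity_line {n : ℕ} (Γ : Fin n → ℝ) (x : Fin n → ℝ) (p u : ℂ) (i : Fin n) :
    velocity Γ (fun i => p + x i * u) i =
      I * ((∑ j, Γ j / (x i - x j) : ℝ) / (‖u‖ ^ 2 : ℝ) * u) := by
  have hterm : ∀ j, ((Γ j / ‖(p + x i * u) - (p + x j * u)‖ ^ 2 : ℝ) : ℂ)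
      * ((p + x j * u) - (p + x i * u)) = -((Γ j / (x i - x j) : ℝ) / (‖u‖ ^ 2 : ℝ) * u) := by
    intro j
    have h1 : (p + x i * u) - (p + x j * u) = ((x i - x j : ℝ) : ℂ) * u := by push_cast; ring
    have h2 : (p + x j * u) - (p + x i * u) = -(((x i - x j : ℝ) : ℂ) * u) := by push_cast; ring
    have h3 : Γ j / (|x i - x j| * ‖u‖) ^ 2 * (x i - x j) = Γ j / (x i - x j) / ‖u‖ ^ 2 := by
      rw [mul_pow, sq_abs]
      rcases eq_or_ne (x i - x j) 0 with h | h
      · simp [h]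
      · by_cases hu : ‖u‖ = 0
        · simp [hu]
        · field_simp
    rw [h2, h1, norm_mul, norm_real, Real.norm_eq_abs, mul_neg, ← mul_assoc, ← ofReal_mul, h3,
      ofReal_div]
  unfold velocity
  rw [Finset.sum_congr rfl fun j _ => hterm j, Finset.sum_neg_distrib, ← Finset.sum_mul,
    ← Finset.sum_div, ← ofReal_sum]
  have : ∑ j ∈ Finset.univ.erase i, Γ j / (x i - x j) = ∑ j, Γ j / (x i - x j) :=
    Finset.sum_erase _ (by simp)
  rw [this]
  ring

/-- Four vortices on the real axis. -/
def toConfig (x : Fin 4 → ℝ) : Config 4 := fun i => (x i : ℂ)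

/-- On a coordinate of its line with origin at vortex 4, a collinear relative equilibrium satisfies
the real equations. The center lies on the line because `ω ≠ 0` and the velocities are normal to
the line. -/
theorem exists_lineEquilibrium {m : ℝ} {z : Config 4} (hz : IsRelativeEquilibrium (circ m) z)
    (hcol : Collinear ℝ (Set.range z)) :
    ∃ (u : ℂ) (x : Fin 4 → ℝ) (ω k : ℝ), u ≠ 0 ∧ ω ≠ 0 ∧ x 3 = 0 ∧ Function.Injective x ∧
      (∀ i, z i = u * x i + z 3) ∧ LineEquilibrium m ω k (x 0) (x 1) (x 2) := by
  obtain ⟨ω, c, hω, -, hsol⟩ := hz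
  obtain ⟨hinj, hvel⟩ := (isSolution_rotate_iff _ _ _ _).1 hsol
  obtain ⟨u, hu⟩ := (collinear_iff_of_mem (p₀ := z 3) (Set.mem_range_self 3)).1 hcol
  choose x' hx' using fun i => hu (z i) (Set.mem_range_self i)
  have hu0 : u ≠ 0 := by
    rintro rfl
    have h01 : z 0 = z 1 := by rw [hx' 0, hx' 1]; simp
    exact absurd (hinj h01) (by decide)
  set x : Fin 4 → ℝ := Function.update x' 3 0 with hxdef
  have hx3 : x 3 = 0 := by simp [hxdef]
  have hx : ∀ i, z i = z 3 + x i * u := by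
    intro i
    by_cases hi : i = 3
    · subst hi; simp [hx3]
    · have : x i = x' i := by simp [hxdef, hi]
      rw [this, add_comm]
      simpa using hx' i
  have hxinj : Function.Injective x := fun i j hij => hinj (by rw [hx i, hx j, hij])
  have hN : 0 < ‖u‖ ^ 2 := by positivity
  have hzfun : z = fun i => z 3 + x i * u := funext hx
  have heq : ∀ i, (ω : ℂ) * (z i - c) =
      ((∑ j, circ m j / (x i - x j) : ℝ) / (‖u‖ ^ 2 : ℝ) * u) := by
    intro i
    have := hvel i
    rw [hzfun, velocity_line, mul_assoc] at this
    have h2 := mul_left_cancel₀ I_ne_zero this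
    rw [← h2]
    simp only [hx i]
  -- the center lies on the line
  obtain ⟨k, hk⟩ : ∃ k : ℝ, c = z 3 + k * u := by
    refine ⟨-((∑ j, circ m j / (x 3 - x j)) / ‖u‖ ^ 2 / ω), ?_⟩
    have h3 := heq 3
    have hω' : (ω : ℂ) ≠ 0 := ofReal_ne_zero.2 hω
    have : z 3 - c = ((∑ j, circ m j / (x 3 - x j) : ℝ) / (‖u‖ ^ 2 : ℝ) * u) / ω := by
      rw [← h3]; field_simp
    rw [ofReal_neg, ofReal_div, ofReal_div]
    linear_combination -this
  have hreal : ∀ i, ∑ j, circ m j / (x i - x j) = ω * ‖u‖ ^ 2 * (x i - k) := by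
    intro i
    have h1 := heq i
    rw [hx i, hk] at h1
    have h2 : ((ω * (x i - k) : ℝ) : ℂ) =
        (((∑ j, circ m j / (x i - x j)) / ‖u‖ ^ 2 : ℝ) : ℂ) := by
      apply mul_right_cancel₀ hu0
      rw [ofReal_div, ← h1]
      push_cast
      ring
    have h3 := ofReal_injective h2
    rw [eq_div_iff hN.ne'] at h3
    linarith
  refine ⟨u, x, ω * ‖u‖ ^ 2, k, hu0, mul_ne_zero hω hN.ne', hx3, hxinj,
    fun i => by rw [hx i]; ring, ?_⟩
  have hne : ∀ i, i ≠ 3 → x i ≠ 0 := fun i hi h => hi (hxinj (h.trans hx3.symm))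
  have e0 := hreal 0
  have e1 := hreal 1
  have e2 := hreal 2
  have e3 := hreal 3
  simp only [Fin.sum_univ_four, circ, hx3, sub_self, div_zero, sub_zero, zero_sub,
    Matrix.cons_val, zero_add, add_zero] at e0 e1 e2 e3
  refine ⟨hne 0 (by decide), hne 1 (by decide), hne 2 (by decide), hxinj.ne (by decide),
    hxinj.ne (by decide), hxinj.ne (by decide), e0, e1, e2, ?_⟩
  simp only [div_neg, neg_zero, div_zero] at e3
  linarith

theorem LineEquilibrium.isRelativeEquilibrium {m ω : ℝ} {x : Fin 4 → ℝ} (hx3 : x 3 = 0)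
    (h : LineEquilibrium m ω 1 (x 0) (x 1) (x 2)) (hω : ω ≠ 0)
    (hsum : x 0 + x 1 + x 2 = m + 3) : IsRelativeEquilibrium (circ m) (toConfig x) := by
  refine ⟨ω, 1, hω, fun hΓ => ?_, (isSolution_rotate_iff _ _ _ _).2 ⟨?_, fun i => ?_⟩⟩
  · have h1 : ∑ i, (circ m i : ℂ) * toConfig x i = ((∑ i, circ m i : ℝ) : ℂ) := by
      simp only [toConfig, ← ofReal_mul, ← ofReal_sum]
      congr 1
      simp [Fin.sum_univ_four, circ, hx3]
      linarith
    rw [centerOfVorticity, h1, div_self (ofReal_ne_zero.2 hΓ)]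
  · intro i j hij
    have hij : x i = x j := ofReal_injective hij
    have n0 := h.ne_a
    have n1 := h.ne_b
    have n2 := h.ne_c
    have n3 := h.ne_ab
    have n4 := h.ne_bc
    have n5 := h.ne_ac
    fin_cases i <;> fin_cases j <;> simp_all
  · have h1 : toConfig x = fun i => (0 : ℂ) + x i * 1 := by funext i; simp [toConfig]
    rw [h1, velocity_line]
    have h2 : ∑ j, circ m j / (x i - x j) = ω * (x i - 1) := by
      have e0 := h.eq_a
      have e1 := h.eq_b
      have e2 := h.eq_c
      have e3 := h.eq_zero
      fin_cases i <;> simp only [Fin.sum_univ_four, circ, Fin.zero_eta, Fin.mk_one,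
        Fin.reduceFinMk, hx3, sub_self, div_zero, sub_zero, zero_sub, Matrix.cons_val, zero_add,
        add_zero, div_neg] <;> linarith
    rw [h2]
    simp
    ring

/-! ### Normalized representatives of classes -/

/-- The normalized real representatives of the classes of collinear relative equilibria: vortex 4 at
`0`, center of vorticity at `1`, angular velocity `1 / v`. -/
structure IsNormalized (m v : ℝ) (x : Fin 4 → ℝ) : Prop where
  zero : x 3 = 0
  inj : Function.Injective x
  form : NormalForm (m + 1) v (x 0) (x 1) (x 2)

theorem neg_one_lt_of_mem {m : ℝ} {q : ConfigClass 4} (hq : q ∈ collinearRE (circ m)) :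
    -1 < m := by
  obtain ⟨z, ⟨hz, hcol⟩, rfl⟩ := hq
  obtain ⟨u, x, ω, k, hu, hω, hx3, hinj, hx, hL⟩ := exists_lineEquilibrium hz hcol
  exact hL.neg_one_lt

/-- The classes of collinear relative equilibria are the classes of normalized configurations. -/
theorem mem_collinearRE_iff {m : ℝ} (hm : -1 < m) {q : ConfigClass 4} :
    q ∈ collinearRE (circ m) ↔
      ∃ v x, IsNormalized m v x ∧ q = Quotient.mk (configSetoid 4) (toConfig x) := by
  constructor
  · rintro ⟨z, ⟨hz, hcol⟩, rfl⟩
    obtain ⟨u, x, ω, k, hu, hω, hx3, hinj, hx, hL⟩ := exists_lineEquilibrium hz hcol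
    have hk := hL.center_ne_zero hω
    have hL' := hL.scale (inv_ne_zero hk)
    rw [inv_mul_cancel₀ hk] at hL'
    refine ⟨_, fun i => k⁻¹ * x i, ⟨by simp [hx3], fun i j hij => ?_,
      hL'.normalForm (div_ne_zero hω (pow_ne_zero 2 (inv_ne_zero hk)))⟩, ?_⟩
    · exact hinj (mul_left_cancel₀ (inv_ne_zero hk) hij)
    · refine Quotient.sound ⟨u * k, z 3, mul_ne_zero hu (ofReal_ne_zero.2 hk), fun i => ?_⟩
      have : (k : ℂ) ≠ 0 := ofReal_ne_zero.2 hk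
      rw [hx i, toConfig]
      push_cast
      field_simp
  · rintro ⟨v, x, ⟨hx3, hinj, hN⟩, rfl⟩
    have hne : ∀ i, i ≠ 3 → x i ≠ 0 := fun i hi h => hi (hinj (h.trans hx3.symm))
    have hv := (hN.v_pos (by linarith)).ne'
    have hL := hN.lineEquilibrium hv (hne 0 (by decide)) (hne 1 (by decide)) (hne 2 (by decide))
      (hinj.ne (by decide)) (hinj.ne (by decide)) (hinj.ne (by decide))
    rw [add_sub_cancel_right] at hL
    refine ⟨toConfig x, ⟨hL.isRelativeEquilibrium hx3 (inv_ne_zero hv)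
      (by rw [hN.sum]; ring), ?_⟩, rfl⟩
    refine (collinear_iff_of_mem (p₀ := toConfig x 3) (Set.mem_range_self 3)).2 ⟨1, ?_⟩
    rintro _ ⟨i, rfl⟩
    exact ⟨x i, by simp [toConfig, hx3]⟩

/-! ### Orderings -/

section Orderings

/-- `σ` lists the points `x i` in increasing or in decreasing order. Both are allowed, as `σ` and its
reversal stand for the same ordering of a line. -/
def Sorts (σ : Equiv.Perm (Fin 4)) (x : Fin 4 → ℝ) : Prop :=
  StrictMono (x ∘ σ) ∨ StrictAnti (x ∘ σ)

/-- Any representative with the ordering `σ` is related to `x` by a similarity which restricts to a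
real affine map between the coordinates on the two lines. -/
theorem classHasOrdering_iff {x : Fin 4 → ℝ} {σ : Equiv.Perm (Fin 4)} :
    ClassHasOrdering (Quotient.mk (configSetoid 4) (toConfig x)) σ ↔ Sorts σ x := by
  constructor
  · rintro ⟨w, hw, p, u, y, hu, hy, hmono⟩
    obtain ⟨a, b, ha, hab⟩ := Quotient.exact hw
    have hdiff : ∀ i j, ((y i - y j : ℝ) : ℂ) = a / u * ((x i - x j : ℝ) : ℂ) := by
      intro i j
      have h1 := hab i
      have h2 := hab j
      rw [hy, toConfig] at h1 h2
      field_simp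
      push_cast
      linear_combination h1 - h2
    have h01 : x (σ 1) - x (σ 0) ≠ 0 := by
      intro h
      have h1 := hdiff (σ 1) (σ 0)
      rw [h, ofReal_zero, mul_zero, ofReal_eq_zero, sub_eq_zero] at h1
      exact (hmono (show (0 : Fin 4) < 1 by decide)).ne' h1
    obtain ⟨r, hr⟩ : ∃ r : ℝ, a / u = r := by
      refine ⟨(y (σ 1) - y (σ 0)) / (x (σ 1) - x (σ 0)), ?_⟩
      rw [ofReal_div, hdiff, mul_div_cancel_right₀ _ (ofReal_ne_zero.2 h01)]
    have hdiff' : ∀ i j, y i - y j = r * (x i - x j) := by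
      intro i j
      have := hdiff i j
      rw [hr] at this
      exact_mod_cast this
    rcases le_or_gt r 0 with hr0 | hr0
    · right
      intro i j hij
      have h1 : y (σ i) < y (σ j) := hmono hij
      have h2 := hdiff' (σ j) (σ i)
      show x (σ j) < x (σ i)
      by_contra! hle
      have := mul_nonpos_of_nonpos_of_nonneg hr0 (sub_nonneg.2 hle)
      linarith
    · left
      intro i j hij
      have h1 : y (σ i) < y (σ j) := hmono hij
      have h2 := hdiff' (σ j) (σ i)
      show x (σ i) < x (σ j)
      by_contra! hle
      have := mul_nonpos_of_nonneg_of_nonpos hr0.le (sub_nonpos.2 hle)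
      linarith
  · rintro (h | h)
    · exact ⟨toConfig x, rfl, 0, 1, x, one_ne_zero, fun i => by simp [toConfig], h⟩
    · exact ⟨toConfig x, rfl, 0, -1, fun i => -x i, by simp, fun i => by simp [toConfig],
        fun i j hij => neg_lt_neg (h hij)⟩

theorem range_comp_perm (x : Fin 4 → ℝ) (σ : Equiv.Perm (Fin 4)) :
    Set.range (x ∘ σ) = Set.range x := σ.surjective.range_comp x

/-- A strictly monotone enumeration of four points is determined by the set of the points. -/
theorem Sorts.eq_or_eq_rev {x y : Fin 4 → ℝ} {σ τ : Equiv.Perm (Fin 4)} (hx : Sorts σ x)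
    (hy : Sorts τ y) (hr : Set.range x = Set.range y) :
    (∀ i, x (σ i) = y (τ i)) ∨ ∀ i, x (σ i) = y (τ i.rev) := by
  have hrev : ∀ w : Fin 4 → ℝ, Set.range (w ∘ Fin.rev) = Set.range w :=
    fun w => Fin.rev_surjective.range_comp w
  have hr' : Set.range (x ∘ σ) = Set.range (y ∘ τ) := by
    rw [range_comp_perm, range_comp_perm, hr]
  rcases hx with hx | hx <;> rcases hy with hy | hy
  · exact Or.inl (congrFun ((hx.range_inj hy).1 hr'))
  · refine Or.inr (congrFun ((hx.range_inj (hy.comp Fin.rev_strictAnti)).1 ?_))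
    rw [hrev, hr']
  · have := (hx.comp Fin.rev_strictAnti).range_inj hy |>.1 (by rw [hrev, hr'])
    refine Or.inr fun i => ?_
    have := congrFun this i.rev
    simpa using this
  · have := (hx.comp Fin.rev_strictAnti).range_inj (hy.comp Fin.rev_strictAnti) |>.1
      (by rw [hrev, hrev, hr'])
    refine Or.inl fun i => ?_
    have := congrFun this i.rev
    simpa using this

theorem exists_sorts {x : Fin 4 → ℝ} (hx : Function.Injective x) :
    ∃ σ ∈ orderings, Sorts σ x := by
  have hmono : StrictMono (x ∘ Tuple.sort x) :=
    (Tuple.monotone_sort x).strictMono_of_injective (hx.comp (Tuple.sort x).injective)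
  set σ := Tuple.sort x
  have hne : σ.symm 0 ≠ σ.symm 1 := σ.symm.injective.ne (by decide)
  rcases hne.lt_or_gt with h | h
  · exact ⟨σ, h, Or.inl hmono⟩
  · exact ⟨Fin.revPerm.trans σ, Fin.rev_lt_rev.2 h, Or.inr (hmono.comp_strictAnti
      Fin.rev_strictAnti)⟩

theorem Sorts.unique {x : Fin 4 → ℝ} (hx : Function.Injective x) {σ τ : Equiv.Perm (Fin 4)}
    (hσ : Sorts σ x) (hτ : Sorts τ x) (hσo : σ ∈ orderings) (hτo : τ ∈ orderings) : σ = τ := by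
  rcases hσ.eq_or_eq_rev hτ rfl with h | h
  · exact Equiv.ext fun i => hx (h i)
  · have hst : σ = Fin.revPerm.trans τ := Equiv.ext fun i => hx (h i)
    subst hst
    exact absurd hτo (not_lt.2 (Fin.rev_lt_rev.1 hσo).le)

theorem groupI_or_groupII (σ : Equiv.Perm (Fin 4)) : GroupI σ ∨ GroupII σ := by
  obtain ⟨k, hk⟩ := σ.surjective 3
  fin_cases k
  · exact Or.inl (Or.inl hk)
  · exact Or.inr (Or.inl hk)
  · exact Or.inr (Or.inr hk)
  · exact Or.inl (Or.inr hk)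

theorem encard_orderings : orderings.encard = 12 := by
  have : orderings = ((Finset.univ.filter fun σ : Equiv.Perm (Fin 4) => σ.symm 0 < σ.symm 1 :
      Finset (Equiv.Perm (Fin 4))) : Set (Equiv.Perm (Fin 4))) := by
    ext; simp [orderings]
  rw [this, Set.encard_coe_eq_coe_finsetCard]
  have : (Finset.univ.filter fun σ : Equiv.Perm (Fin 4) => σ.symm 0 < σ.symm 1).card = 12 := by
    decide
  rw [this]; rfl

theorem encard_orderings_groupI : {σ ∈ orderings | GroupI σ}.encard = 6 := by
  have : {σ ∈ orderings | GroupI σ} = ((Finset.univ.filter fun σ : Equiv.Perm (Fin 4) =>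
      σ.symm 0 < σ.symm 1 ∧ (σ 0 = 3 ∨ σ 3 = 3) :
      Finset (Equiv.Perm (Fin 4))) : Set (Equiv.Perm (Fin 4))) := by
    ext; simp [orderings, GroupI]
  rw [this, Set.encard_coe_eq_coe_finsetCard]
  have : (Finset.univ.filter fun σ : Equiv.Perm (Fin 4) =>
      σ.symm 0 < σ.symm 1 ∧ (σ 0 = 3 ∨ σ 3 = 3)).card = 6 := by
    decide
  rw [this]; rfl

end Orderings

/-! ### Normalized configurations with a given ordering -/

namespace IsNormalized

variable {m v v' : ℝ} {x x' : Fin 4 → ℝ} {σ : Equiv.Perm (Fin 4)}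

theorem range_subset (h : IsNormalized m v x) (h' : IsNormalized m v x') :
    Set.range x ⊆ Set.range x' := by
  have key : ∀ i, (x i - x 0) * (x i - x 1) * (x i - x 2) = 0 → x i ∈ Set.range x' := by
    intro i hi
    rw [h.form.factor, ← h'.form.factor] at hi
    rcases mul_eq_zero.1 hi with hi | hi
    · rcases mul_eq_zero.1 hi with hi | hi
      · exact ⟨0, (sub_eq_zero.1 hi).symm⟩
      · exact ⟨1, (sub_eq_zero.1 hi).symm⟩
    · exact ⟨2, (sub_eq_zero.1 hi).symm⟩
  rintro _ ⟨i, rfl⟩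
  fin_cases i
  · exact key 0 (by ring)
  · exact key 1 (by ring)
  · exact key 2 (by ring)
  · exact ⟨3, h'.zero.trans h.zero.symm⟩

/-- The alternative that `x` and `x'` are sorted in opposite directions is excluded by vortex 4, which
is at `0` in both: its place would be fixed by the reversal of four places. -/
theorem eq_of_sorts (h : IsNormalized m v x) (h' : IsNormalized m v x') (hs : Sorts σ x)
    (hs' : Sorts σ x') : x = x' := by
  rcases hs.eq_or_eq_rev hs' ((h.range_subset h').antisymm (h'.range_subset h)) with e | e
  · funext i
    simpa using e (σ.symm i)
  · exfalso
    have h1 := e (σ.symm 3)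
    rw [Equiv.apply_symm_apply, h.zero, ← h'.zero] at h1
    have h2 : σ.symm 3 = (σ.symm 3).rev := σ.injective
      ((Equiv.apply_symm_apply _ _).trans (h'.inj h1))
    revert h2
    generalize σ.symm 3 = k
    revert k
    decide

theorem pos_of_groupI (hm : -1 < m) (h : IsNormalized m v x) (hs : Sorts σ x) (hσ : GroupI σ) :
    ∀ i, i ≠ 3 → 0 < x i := by
  have key : (∀ i, i ≠ 3 → 0 < x i) ∨ ∀ i, i ≠ 3 → x i < 0 := by
    have h0 : σ 0 = 3 → ∀ i, i ≠ 3 → 0 < σ.symm i := fun h0 i hi =>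
      Fin.pos_iff_ne_zero.2 fun e => hi (by rw [← h0, ← e, Equiv.apply_symm_apply])
    have h3 : σ 3 = 3 → ∀ i, i ≠ 3 → σ.symm i < 3 := fun h3 i hi =>
      lt_of_le_of_ne (Fin.le_last _) fun e => hi (by rw [← h3, ← e, Equiv.apply_symm_apply])
    rcases hs with hs | hs <;> rcases hσ with hσ | hσ
    · refine Or.inl fun i hi => ?_
      simpa [hσ, h.zero] using hs (h0 hσ i hi)
    · refine Or.inr fun i hi => ?_
      simpa [hσ, h.zero] using hs (h3 hσ i hi)
    · refine Or.inr fun i hi => ?_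
      simpa [hσ, h.zero] using hs (h0 hσ i hi)
    · refine Or.inl fun i hi => ?_
      simpa [hσ, h.zero] using hs (h3 hσ i hi)
  refine key.resolve_right fun hneg => ?_
  have := h.form.sum
  linarith [hneg 0 (by decide), hneg 1 (by decide), hneg 2 (by decide)]

theorem lt_of_groupI (hm : -1 < m) (h : IsNormalized m v x) (hs : Sorts σ x) (hσ : GroupI σ) :
    v < m + 1 + 1 := by
  have hp := h.pos_of_groupI hm hs hσ
  exact h.form.lt_of_pos (by linarith) (hp 0 (by decide)) (hp 1 (by decide)) (hp 2 (by decide))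
    (h.inj.ne (by decide)) (h.inj.ne (by decide)) (h.inj.ne (by decide))

theorem neg_of_groupII (h : IsNormalized m v x) (hs : Sorts σ x) (hσ : GroupII σ) :
    ∃ i, i ≠ 3 ∧ x i < 0 := by
  have key : ∀ k : Fin 4, (k = 0 ∨ k = 3) → σ k ≠ 3 := by
    rintro k hk e
    rcases hσ with hσ | hσ <;> rcases hk with rfl | rfl <;>
      exact absurd (σ.injective (e.trans hσ.symm)) (by decide)
  rcases hs with hs | hs
  · refine ⟨σ 0, key 0 (Or.inl rfl), ?_⟩
    rcases hσ with hσ | hσ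
    · simpa [hσ, h.zero] using hs (show (0 : Fin 4) < 1 by decide)
    · simpa [hσ, h.zero] using hs (show (0 : Fin 4) < 2 by decide)
  · refine ⟨σ 3, key 3 (Or.inr rfl), ?_⟩
    rcases hσ with hσ | hσ
    · simpa [hσ, h.zero] using hs (show (1 : Fin 4) < 3 by decide)
    · simpa [hσ, h.zero] using hs (show (2 : Fin 4) < 3 by decide)

theorem exists_form_neg (h : IsNormalized m v x) (hs : Sorts σ x) (hσ : GroupII σ) :
    ∃ a b c, a < 0 ∧ NormalForm (m + 1) v a b c := by
  obtain ⟨i, hi, hneg⟩ := h.neg_of_groupII hs hσ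
  fin_cases i
  · exact ⟨_, _, _, hneg, h.form⟩
  · exact ⟨_, _, _, hneg, h.form.swap_ab⟩
  · exact ⟨_, _, _, hneg, h.form.swap_bc.swap_ab⟩
  · exact absurd rfl hi

theorem eq_of_groupI (hm : -1 < m) (h : IsNormalized m v x) (h' : IsNormalized m v' x')
    (hs : Sorts σ x) (hs' : Sorts σ x') (hσ : GroupI σ) : x = x' := by
  have h1 := h.lt_of_groupI hm hs hσ
  have h2 := h'.lt_of_groupI hm hs' hσ
  have hv : v = v' := periodQuadratic_root_unique (by linarith) h.form.quad h'.form.quad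
    (w := m + 1 + 1) (by rw [periodQuadratic_mid, neg_lt_zero]
                         exact mul_pos (by linarith) (by linarith))
    (mul_nonneg (by linarith) (by linarith))
  subst hv
  exact h.eq_of_sorts h' hs hs'

theorem neg_half_lt_of_groupII (hm : -1 < m) (h : IsNormalized m v x) (hs : Sorts σ x)
    (hσ : GroupII σ) : -1 / 2 < m := by
  obtain ⟨a, b, c, ha, hN⟩ := h.exists_form_neg hs hσ
  linarith [hN.half_lt_of_neg (by linarith) ha]

theorem eq_of_groupII (hm : -1 / 2 < m) (h : IsNormalized m v x) (h' : IsNormalized m v' x')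
    (hs : Sorts σ x) (hs' : Sorts σ x') (hσ : GroupII σ) : x = x' := by
  obtain ⟨a, b, c, ha, hN⟩ := h.exists_form_neg hs hσ
  obtain ⟨a', b', c', ha', hN'⟩ := h'.exists_form_neg hs' hσ
  have ht : 0 < m + 1 := by linarith
  have h1 := hN.lt_of_neg ht ha
  have h2 := hN'.lt_of_neg ht ha'
  have hv : v = v' := periodQuadratic_root_unique ht h.form.quad h'.form.quad
    (w := (m + 1 + 1) * (m + 1 + 2) / (3 * (m + 1)))
    (by rw [periodQuadratic_pairSum_zero ht.ne', neg_lt_zero]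
        exact mul_pos (mul_pos (by linarith) (by linarith))
          (div_pos (mul_pos (by linarith) (by linarith)) (by linarith)))
    (mul_nonneg_of_nonpos_of_nonpos (by linarith) (by linarith))
  subst hv
  exact h.eq_of_sorts h' hs hs'

/-- A relabelling of the four points `0, a, b, c` preserves the product in the hypothesis, so it
suffices to know this product and that vortex 4 is at `0`. -/
theorem of_prod (hinj : Function.Injective x) (h3 : x 3 = 0) (hq : periodQuadratic (m + 1) v = 0)
    (hp : ∀ X, ∏ i, (X - x i) = X * cubic (m + 1) v X) : IsNormalized m v x := by
  refine ⟨h3, hinj, hq, fun X => ?_⟩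
  simp only [Fin.prod_univ_four, h3] at hp
  have h1 := hp 1
  have h2 := hp (-1)
  have h4 := hp 2
  -- two cubics with equal leading coefficients that agree at `1`, `-1`, `2` are equal
  unfold cubic at *
  linear_combination (X + 1) * (X - 2) / (-2) * h1 - (X - 1) * (X - 2) / 6 * h2
    + (X ^ 2 - 1) / 6 * h4

/-- Distributing increasing points among the vortices along `σ` or along its reversal. -/
theorem exists_sorts_of_sorted {s : Fin 4 → ℝ} (hs : StrictMono s) {k : Fin 4} (hk : s k = 0)
    (hq : periodQuadratic (m + 1) v = 0) (hp : ∀ X, ∏ i, (X - s i) = X * cubic (m + 1) v X)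
    (hσ : σ k = 3 ∨ σ k.rev = 3) : ∃ x, IsNormalized m v x ∧ Sorts σ x := by
  rcases hσ with hσ | hσ
  · refine ⟨s ∘ σ.symm, of_prod (hs.injective.comp σ.symm.injective) ?_ hq fun X => ?_, Or.inl ?_⟩
    · rw [← hσ]; simpa using hk
    · rw [← hp]; exact Equiv.prod_comp σ.symm fun i => X - s i
    · intro i j hij
      simpa using hs hij
  · refine ⟨s ∘ (σ.symm.trans Fin.revPerm), of_prod (hs.injective.comp (Equiv.injective _)) ?_ hq
      fun X => ?_, Or.inr ?_⟩
    · rw [← hσ]; simpa using hk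
    · rw [← hp]; exact Equiv.prod_comp (σ.symm.trans Fin.revPerm) fun i => X - s i
    · intro i j hij
      simpa using hs (Fin.rev_lt_rev.2 hij)

theorem exists_of_groupI (hm : -1 < m) (hσ : GroupI σ) : ∃ v x, IsNormalized m v x ∧ Sorts σ x := by
  obtain ⟨v, a, b, c, ha, hab, hbc, hN⟩ := exists_normalForm_exterior (t := m + 1) (by linarith)
  refine ⟨v, exists_sorts_of_sorted (s := ![0, a, b, c]) (k := 0) ?_ rfl hN.quad (fun X => ?_) hσ⟩
  · rw [Fin.strictMono_iff_lt_succ]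
    intro i
    fin_cases i <;> simpa
  · rw [← hN.factor]
    simp [Fin.prod_univ_four]
    ring

theorem exists_of_groupII (hm : -1 / 2 < m) (hσ : GroupII σ) :
    ∃ v x, IsNormalized m v x ∧ Sorts σ x := by
  obtain ⟨v, a, b, c, ha, hab, hbc, hN⟩ := exists_normalForm_between (t := m + 1) (by linarith)
  refine ⟨v, exists_sorts_of_sorted (s := ![a, 0, b, c]) (k := 1) ?_ rfl hN.quad (fun X => ?_) hσ⟩
  · rw [Fin.strictMono_iff_lt_succ]
    intro i
    fin_cases i <;> simpa
  · rw [← hN.factor]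
    simp [Fin.prod_univ_four]
    ring

end IsNormalized

/-! ### Counting classes -/

theorem existsUnique_class_of_groupI {m : ℝ} (hm : -1 < m) {σ : Equiv.Perm (Fin 4)}
    (hσ : GroupI σ) : ∃! q : ConfigClass 4, q ∈ collinearRE (circ m) ∧ ClassHasOrdering q σ := by
  obtain ⟨v, x, hx, hs⟩ := IsNormalized.exists_of_groupI hm hσ
  refine ⟨_, ⟨(mem_collinearRE_iff hm).2 ⟨v, x, hx, rfl⟩, classHasOrdering_iff.2 hs⟩, ?_⟩
  rintro q ⟨hq, hqσ⟩
  obtain ⟨v', x', hx', rfl⟩ := (mem_collinearRE_iff hm).1 hq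
  rw [hx'.eq_of_groupI hm hx (classHasOrdering_iff.1 hqσ) hs hσ]

theorem existsUnique_class_of_groupII {m : ℝ} (hm : -1 / 2 < m) {σ : Equiv.Perm (Fin 4)}
    (hσ : GroupII σ) : ∃! q : ConfigClass 4, q ∈ collinearRE (circ m) ∧ ClassHasOrdering q σ := by
  have hm' : -1 < m := by linarith
  obtain ⟨v, x, hx, hs⟩ := IsNormalized.exists_of_groupII hm hσ
  refine ⟨_, ⟨(mem_collinearRE_iff hm').2 ⟨v, x, hx, rfl⟩, classHasOrdering_iff.2 hs⟩, ?_⟩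
  rintro q ⟨hq, hqσ⟩
  obtain ⟨v', x', hx', rfl⟩ := (mem_collinearRE_iff hm').1 hq
  rw [hx'.eq_of_groupII hm hx (classHasOrdering_iff.1 hqσ) hs hσ]

theorem not_classHasOrdering_of_groupII {m : ℝ} (hm : m ≤ -1 / 2) {q : ConfigClass 4}
    (hq : q ∈ collinearRE (circ m)) {σ : Equiv.Perm (Fin 4)} (hσ : GroupII σ) :
    ¬ ClassHasOrdering q σ := by
  intro hqσ
  have hm' := neg_one_lt_of_mem hq
  obtain ⟨v, x, hx, rfl⟩ := (mem_collinearRE_iff hm').1 hq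
  linarith [hx.neg_half_lt_of_groupII hm' (classHasOrdering_iff.1 hqσ) hσ]

theorem exists_ordering {m : ℝ} {q : ConfigClass 4} (hq : q ∈ collinearRE (circ m)) :
    ∃ σ ∈ orderings, ClassHasOrdering q σ := by
  obtain ⟨v, x, hx, rfl⟩ := (mem_collinearRE_iff (neg_one_lt_of_mem hq)).1 hq
  obtain ⟨σ, hσ, hs⟩ := exists_sorts hx.inj
  exact ⟨σ, hσ, classHasOrdering_iff.2 hs⟩

theorem ordering_unique {m : ℝ} {q : ConfigClass 4} (hq : q ∈ collinearRE (circ m))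
    {σ τ : Equiv.Perm (Fin 4)} (hσ : ClassHasOrdering q σ) (hτ : ClassHasOrdering q τ)
    (hσo : σ ∈ orderings) (hτo : τ ∈ orderings) : σ = τ := by
  obtain ⟨v, x, hx, rfl⟩ := (mem_collinearRE_iff (neg_one_lt_of_mem hq)).1 hq
  exact (classHasOrdering_iff.1 hσ).unique hx.inj (classHasOrdering_iff.1 hτ) hσo hτo

theorem encard_eq_of_existsUnique {α β : Type*} [Nonempty β] {S : Set α} {C : Set β}
    {R : β → α → Prop}
    (h1 : ∀ a ∈ S, ∃! b, b ∈ C ∧ R b a) (h2 : ∀ b ∈ C, ∃ a ∈ S, R b a)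
    (h3 : ∀ b ∈ C, ∀ a ∈ S, ∀ a' ∈ S, R b a → R b a' → a = a') : C.encard = S.encard := by
  choose! f hf hfu using h1
  have hC : C = f '' S := by
    ext b
    constructor
    · intro hb
      obtain ⟨a, ha, hab⟩ := h2 b hb
      exact ⟨a, ha, (hfu a ha b ⟨hb, hab⟩).symm⟩
    · rintro ⟨a, ha, rfl⟩
      exact (hf a ha).1
  have hinj : Set.InjOn f S := fun a ha a' ha' e =>
    h3 (f a) (hf a ha).1 a ha a' ha' (hf a ha).2 (e ▸ (hf a' ha').2)
  rw [hC, hinj.encard_image]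

end Vortex

open Vortex in
theorem theorem2p5 (m : ℝ) :
    (-1 / 2 < m →
      (collinearRE (circ m)).encard = 12 ∧
      ∀ σ ∈ orderings, ∃! q : ConfigClass 4, q ∈ collinearRE (circ m) ∧ ClassHasOrdering q σ) ∧
    (-1 < m → m ≤ -1 / 2 →
      (collinearRE (circ m)).encard = 6 ∧
      (∀ σ ∈ orderings, GroupI σ →
        ∃! q : ConfigClass 4, q ∈ collinearRE (circ m) ∧ ClassHasOrdering q σ) ∧
      ∀ σ ∈ orderings, GroupII σ →
        ¬ ∃ q : ConfigClass 4, q ∈ collinearRE (circ m) ∧ ClassHasOrdering q σ) ∧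
    (m ≤ -1 → collinearRE (circ m) = ∅) := by
  refine ⟨fun hm => ?_, fun hm hm' => ?_, fun hm => ?_⟩
  · have h1 : ∀ σ ∈ orderings,
        ∃! q : ConfigClass 4, q ∈ collinearRE (circ m) ∧ ClassHasOrdering q σ := fun σ _ =>
      (groupI_or_groupII σ).elim (existsUnique_class_of_groupI (by linarith))
        (existsUnique_class_of_groupII hm)
    refine ⟨?_, h1⟩
    rw [← encard_orderings]
    exact encard_eq_of_existsUnique h1 (fun q hq => exists_ordering hq)
      fun q hq σ hσ τ hτ h h' => ordering_unique hq h h' hσ hτ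
  · refine ⟨?_, fun σ _ hσ => existsUnique_class_of_groupI hm hσ,
      fun σ _ hσ ⟨q, hq, h⟩ => not_classHasOrdering_of_groupII hm' hq hσ h⟩
    rw [← encard_orderings_groupI]
    refine encard_eq_of_existsUnique (R := ClassHasOrdering)
      (fun σ hσ => existsUnique_class_of_groupI hm hσ.2)
      (fun q hq => ?_) fun q hq σ hσ τ hτ h h' => ordering_unique hq h h' hσ.1 hτ.1
    obtain ⟨σ, hσ, h⟩ := exists_ordering hq
    exact ⟨σ, ⟨hσ, (groupI_or_groupII σ).resolve_right fun h2 =>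
      not_classHasOrdering_of_groupII hm' hq h2 h⟩, h⟩
  · refine Set.eq_empty_of_forall_notMem fun q hq => ?_
    linarith [neg_one_lt_of_mem hq]
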